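/- Let $G$ be a group admitting a balanced finite presentation, i.e. a presentation $\langle a_1,\dots,a_n \mid R_1,\dots,R_n\rangle$ with finitely many generators and equally many relators. Let $p$ be a prime, let $r \ge 0$ be an integer, and let $N$ be a normal subgroup of $G$ with $G/N \cong (\mathbb{Z}/p\mathbb{Z})^r$. For a group $\Gamma$ write $b_1(\Gamma;\mathbb{F}_p) = \dim_{\mathbb{F}_p} H_1(\Gamma;\mathbb{F}_p)$, and for $k \ge 0$ let $$\Omega^k_{p,r} = \{(j_1,\dots,j_r)\in\mathbb{Z}^r : 0\le j_i\le p-1 \text{ for all } i,\ j_1+\cdots+j_r=k\}.$$ Then $$b_1(N;\mathbb{F}_p) \;\ge\; 1 + r\,\bigl|\Omega^{\lfloor r(p-1)/2\rfloor}_{p,r}\bigr| - p^r .$$ Moreover, if equality holds, then $b_1(G;\mathbb{F}_p) = r$. -/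

import Mathlib

/-- `R₁, …, Rₘ` (a finite family, repetitions allowed) are the relators of a presentation
`⟨a₁, …, aₙ ∣ R₁, …, Rₘ⟩` of the group `G`. -/
def IsFinitePresentationOf {n m : ℕ} (R : Fin m → FreeGroup (Fin n)) (G : Type*) [Group G] :
    Prop :=
  Nonempty (PresentedGroup (Set.range R) ≃* G)

/-- `G` has a finite presentation with as many relators as generators. -/
def HasBalancedPresentation (G : Type*) [Group G] : Prop :=
  ∃ (n : ℕ) (R : Fin n → FreeGroup (Fin n)), IsFinitePresentationOf R G

universe u

/-- `b₁(G; 𝔽_p) = dim H₁(G; 𝔽_p)`, the first homology of `G` with coefficients in the trivial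
module `𝔽_p`. The lift only places the field `𝔽_p` in the universe of `G`. -/
noncomputable def b1 (p : ℕ) [Fact p.Prime] (G : Type u) [Group G] : ℕ :=
  Module.finrank (ULift.{u} (ZMod p))
    (groupHomology.H1 (Rep.trivial (ULift.{u} (ZMod p)) G (ULift.{u} (ZMod p))))

/-- The set of `(j₁, …, j_r)` with `0 ≤ jᵢ ≤ p - 1` and `j₁ + ⋯ + j_r = k`. -/
def Omega (p r k : ℕ) : Finset (Fin r → ℕ) :=
  (Fintype.piFinset fun _ => Finset.range p).filter fun j => ∑ i, j i = k

/-! Let `K` be the field with `p` elements and let `G` act by translations on `V`, the functions on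
`G/N ≅ K^r`. The space Z¹(G, V) of crossed homomorphisms is estimated in two ways.

Above (`finrank_crossedHoms_translationRep_lt`): as in Shapiro's lemma, evaluation at 0 gives dim Z¹
≤ b₁(N) + p^r - 1.

Below (`finrank_mul_le_finrank_crossedHoms`): let V₀ be the functions of degree < m and C the span
of reduced monomials of degree m. Translation lowers degree, so `G` acts trivially on V₀ ⊔ C modulo
V₀. On the free group, generator values may be chosen freely; choose them as Σ χ_s y_s modulo V₀,
with χ_s a basis of Hom(G, K) and y_s in C. Such cocycles send relators into V₀, so n relators
impose n dim V₀ conditions, exactly offset by the free V₀-parts of the n generators. Hence b₁(G)·dim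
C ≤ dim Z¹, with dim C = |Ω^m|.

Finally b₁(G) ≥ r, since `G` maps onto K^r; equality in the bound forces b₁(G) = r because Ω^m is
nonempty. -/

/-- Crossed homomorphisms (1-cocycles) with values in a representation. -/
def crossedHoms {K G V : Type*} [CommSemiring K] [Group G] [AddCommMonoid V] [Module K V]
    (ρ : Representation K G V) : Submodule K (G → V) where
  carrier := {f | ∀ g h, f (g * h) = f g + ρ g (f h)}
  zero_mem' := by simp
  add_mem' := by
    intro a b ha hb g h
    simp only [Pi.add_apply, ha g h, hb g h, map_add]
    abel
  smul_mem' := by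
    intro c a ha g h
    simp only [Pi.smul_apply, ha g h, map_smul, smul_add]

/-- Homomorphisms from a group to the additive group of `K`. -/
abbrev additiveCharacters (K G : Type*) [CommSemiring K] [Group G] : Submodule K (G → K) :=
  crossedHoms (Representation.trivial K G K)

/-! ### Crossed homomorphisms: generators, free groups, descent to quotients -/

section CrossedHoms

variable {K G V : Type*} [Field K] [Group G] [AddCommGroup V] [Module K V]
  {ρ : Representation K G V} {f : G → V}

theorem crossedHoms_one (hf : f ∈ crossedHoms ρ) : f 1 = 0 := by
  have := hf 1 1
  simpa using this

theorem crossedHoms_inv (hf : f ∈ crossedHoms ρ) (g : G) : f g⁻¹ = -ρ g⁻¹ (f g) := by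
  have := hf g⁻¹ g
  rw [inv_mul_cancel, crossedHoms_one hf] at this
  exact eq_neg_of_add_eq_zero_left this.symm

/-- A crossed homomorphism mapping generators into an invariant subspace takes values there. -/
theorem crossedHoms_mem_of_closure {s : Set G} (hs : Subgroup.closure s = ⊤)
    (hf : f ∈ crossedHoms ρ) (U : Submodule K V) (hU : ∀ g, ∀ u ∈ U, ρ g u ∈ U)
    (h : ∀ g ∈ s, f g ∈ U) (g : G) : f g ∈ U := by
  have hg : g ∈ Subgroup.closure s := hs ▸ Subgroup.mem_top g
  induction hg using Subgroup.closure_induction with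
  | mem x hx => exact h x hx
  | one => rw [crossedHoms_one hf]; exact U.zero_mem
  | mul x y _ _ hx hy => rw [hf]; exact U.add_mem hx (hU _ _ hy)
  | inv x _ hx => rw [crossedHoms_inv hf]; exact U.neg_mem (hU _ _ hx)

theorem crossedHoms_eq_zero_of_closure {s : Set G} (hs : Subgroup.closure s = ⊤)
    (hf : f ∈ crossedHoms ρ) (h : ∀ g ∈ s, f g = 0) : f = 0 := by
  funext g
  simpa using crossedHoms_mem_of_closure hs hf ⊥ (by simp) (by simpa using h) g

theorem finite_crossedHoms [Group.FG G] [Module.Finite K V] : Module.Finite K (crossedHoms ρ) := by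
  obtain ⟨s, hs⟩ := Group.fg_def.mp ‹Group.FG G›
  let e : crossedHoms ρ →ₗ[K] (s → V) :=
    { toFun := fun f i => f.1 i
      map_add' := fun _ _ => rfl
      map_smul' := fun _ _ => rfl }
  refine Module.Finite.of_injective e ((injective_iff_map_eq_zero e).mpr fun f hf => ?_)
  exact Subtype.ext (crossedHoms_eq_zero_of_closure hs f.2
    fun g hg => congrFun hf ⟨g, hg⟩)

/-- Crossed homomorphisms out of a free group, restricted to the generators. -/
def crossedHomsEval {α : Type*} (ρ : Representation K (FreeGroup α) V) :
    crossedHoms ρ →ₗ[K] (α → V) where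
  toFun f i := f.1 (FreeGroup.of i)
  map_add' _ _ := rfl
  map_smul' _ _ := rfl

/-- A crossed homomorphism `f` amounts to an action by affine maps `x ↦ ρ w x + f w`, and on a free
group these may be prescribed on generators; `f w` is recovered as the image of 0. -/
theorem crossedHomsEval_bijective {α : Type*} (ρ : Representation K (FreeGroup α) V) :
    Function.Bijective (crossedHomsEval ρ) := by
  constructor
  · refine (injective_iff_map_eq_zero _).mpr fun f hf => ?_
    refine Subtype.ext (crossedHoms_eq_zero_of_closure (FreeGroup.closure_range_of α) f.2 ?_)
    rintro _ ⟨i, rfl⟩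
    exact congrFun hf i
  · intro v
    let aff : α → Equiv.Perm V := fun i =>
      { toFun := fun x => ρ (FreeGroup.of i) x + v i
        invFun := fun x => ρ (FreeGroup.of i)⁻¹ (x - v i)
        left_inv := fun x => by simp
        right_inv := fun x => by simp }
    let Θ : FreeGroup α →* Equiv.Perm V := FreeGroup.lift aff
    have hΘ : ∀ w x, Θ w x = ρ w x + Θ w 0 := by
      intro w
      induction w using FreeGroup.induction_on with
      | C1 => simp
      | of i => intro x; simp [Θ, aff]
      | inv_of i _ =>
        intro x
        simp only [Θ, map_inv, FreeGroup.lift_apply_of]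
        change ρ (FreeGroup.of i)⁻¹ (x - v i) = _ + ρ (FreeGroup.of i)⁻¹ (0 - v i)
        simp [sub_eq_add_neg]
      | mul a b ha hb =>
        intro x
        rw [map_mul, Equiv.Perm.mul_apply, Equiv.Perm.mul_apply, hb x, ha, ha (Θ b 0)]
        simp [add_assoc]
    refine ⟨⟨fun w => Θ w 0, fun a b => ?_⟩, ?_⟩
    · change Θ (a * b) 0 = Θ a 0 + ρ a (Θ b 0)
      rw [map_mul, Equiv.Perm.mul_apply, hΘ, add_comm]
    · funext i
      simp [crossedHomsEval, Θ, aff]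

/-- A crossed homomorphism vanishing on normal generators of the kernel of a surjection
descends. -/
theorem exists_crossedHoms_comp {F : Type*} [Group F] {π : F →* G}
    (hπ : Function.Surjective π) {s : Set F} (hs : π.ker = Subgroup.normalClosure s)
    {f : F → V} (hf : f ∈ crossedHoms (ρ.comp π)) (h : ∀ x ∈ s, f x = 0) :
    ∃ f' ∈ crossedHoms ρ, f' ∘ π = f := by
  have hker : ∀ x ∈ π.ker, f x = 0 := by
    intro x hx
    -- Normality of `S` uses that `ρ.comp π` is trivial on `π.ker`.
    let S : Subgroup F :=
      { carrier := {x | π x = 1 ∧ f x = 0}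
        one_mem' := ⟨map_one π, crossedHoms_one hf⟩
        mul_mem' := by
          rintro a b ⟨ha, ha'⟩ ⟨hb, hb'⟩
          exact ⟨by simp [ha, hb], by rw [hf]; simp [ha', hb']⟩
        inv_mem' := by
          rintro a ⟨ha, ha'⟩
          exact ⟨by simp [ha], by rw [crossedHoms_inv hf]; simp [ha']⟩ }
    have : S.Normal := by
      refine ⟨?_⟩
      rintro a ⟨ha, ha'⟩ g
      refine ⟨by simp [ha], ?_⟩
      rw [hf, hf, crossedHoms_inv hf]
      simp [ha, ha']
    have hle : Subgroup.normalClosure s ≤ S := Subgroup.normalClosure_le_normal fun y hy =>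
      ⟨MonoidHom.mem_ker.mp (hs ▸ Subgroup.subset_normalClosure hy), h y hy⟩
    exact (hle (hs ▸ hx)).2
  have hfib : ∀ x y, π x = π y → f x = f y := by
    intro x y hxy
    have hz : f (x⁻¹ * y) = 0 := hker _ (by simp [MonoidHom.mem_ker, hxy])
    have := hf x (x⁻¹ * y)
    rw [mul_inv_cancel_left, hz, map_zero, add_zero] at this
    exact this.symm
  have hinv : ∀ x, f (Function.surjInv hπ (π x)) = f x :=
    fun x => hfib _ _ (Function.surjInv_eq hπ _)
  refine ⟨fun g => f (Function.surjInv hπ g), fun g g' => ?_, funext hinv⟩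
  obtain ⟨x, rfl⟩ := hπ g
  obtain ⟨y, rfl⟩ := hπ g'
  beta_reduce
  rw [← map_mul, hinv, hinv, hinv, hf]
  rfl

end CrossedHoms

/-! ### Counting cocycles with a balanced presentation -/

section DeficiencyZero

variable {K G V : Type*} [Field K] [Group G] [AddCommGroup V] [Module K V]

/-- Let `V₀` and `C` be independent subspaces of a representation of a group with a balanced
presentation such that the group acts trivially on `V₀ ⊔ C` modulo `V₀`. -/
theorem finrank_mul_le_finrank_crossedHoms [Module.Finite K V] (hG : HasBalancedPresentation G)
    (ρ : Representation K G V) (V₀ C : Submodule K V) (hdisj : Disjoint C V₀)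
    (h₀ : ∀ g, ∀ v ∈ V₀, ρ g v ∈ V₀) (hC : ∀ g, ∀ v ∈ C, ρ g v - v ∈ V₀) :
    Module.finrank K (additiveCharacters K G) * Module.finrank K C ≤
      Module.finrank K (crossedHoms ρ) := by
  obtain ⟨n, R, ⟨e⟩⟩ := hG
  let π : FreeGroup (Fin n) →* G := e.toMonoidHom.comp (PresentedGroup.mk (Set.range R))
  have hπ : Function.Surjective π := e.surjective.comp (PresentedGroup.mk_surjective _)
  have hker : π.ker = Subgroup.normalClosure (Set.range R) := by
    ext x
    change e _ = 1 ↔ _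
    rw [EmbeddingLike.map_eq_one_iff]
    exact PresentedGroup.mk_eq_one_iff
  have hgen : Subgroup.closure (Set.range fun i => π (FreeGroup.of i)) = ⊤ := by
    rw [show (fun i => π (FreeGroup.of i)) = π ∘ FreeGroup.of from rfl, Set.range_comp,
      ← MonoidHom.map_closure, FreeGroup.closure_range_of, ← MonoidHom.range_eq_map,
      MonoidHom.range_eq_top.mpr hπ]
  have : Group.FG G := Group.fg_iff.mpr ⟨_, hgen, Set.finite_range _⟩
  have := finite_crossedHoms (ρ := ρ)
  have := finite_crossedHoms (ρ := Representation.trivial K G K)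
  let E := LinearEquiv.ofBijective _ (crossedHomsEval_bijective (ρ.comp π))
  have hE : ∀ v i, (E.symm v).1 (FreeGroup.of i) = v i :=
    fun v i => congrFun (E.apply_symm_apply v) i
  let b := Module.finrank K (additiveCharacters K G)
  let χ : Module.Basis (Fin b) K (additiveCharacters K G) := Module.finBasis K _
  let J : ((Fin b → C) × (Fin n → V₀)) →ₗ[K] (Fin n → V) :=
    { toFun := fun yz j => ∑ s, (χ s).1 (π (FreeGroup.of j)) • (yz.1 s : V) + yz.2 j
      map_add' := by
        intro a b
        funext j
        simp only [Prod.fst_add, Prod.snd_add, Pi.add_apply, Submodule.coe_add, smul_add,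
          Finset.sum_add_distrib]
        abel
      map_smul' := by
        intro c a
        funext j
        simp only [Prod.smul_fst, Prod.smul_snd, Pi.smul_apply, Submodule.coe_smul, smul_add,
          Finset.smul_sum, RingHom.id_apply, smul_comm c] }
  have hJ : Function.Injective J := by
    refine (injective_iff_map_eq_zero J).mpr fun yz hyz => ?_
    have hj : ∀ j, ∑ s, (χ s).1 (π (FreeGroup.of j)) • (yz.1 s : V) + yz.2 j = 0 :=
      fun j => congrFun hyz j
    have hsum : ∀ j, ∑ s, (χ s).1 (π (FreeGroup.of j)) • yz.1 s = 0 := by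
      intro j
      have hmem : (∑ s, (χ s).1 (π (FreeGroup.of j)) • (yz.1 s : V)) ∈ V₀ := by
        rw [eq_neg_of_add_eq_zero_left (hj j)]
        exact V₀.neg_mem (yz.2 j).2
      apply Subtype.ext
      simpa using Submodule.disjoint_def.mp hdisj _
        (C.sum_mem fun s _ => C.smul_mem _ (yz.1 s).2) hmem
    have hy : yz.1 = 0 := by
      funext s
      -- Applying a functional on `C` turns the relation into a scalar one among the independent `χ
      -- s`.
      refine (Module.forall_dual_apply_eq_zero_iff K _).mp fun φ => ?_
      have hz : ∑ t, φ (yz.1 t) • χ t = 0 := by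
        refine Subtype.ext (crossedHoms_eq_zero_of_closure hgen (Subtype.prop _) ?_)
        rintro _ ⟨j, rfl⟩
        have := congrArg φ (hsum j)
        simpa [Finset.sum_apply, mul_comm] using this
      exact Fintype.linearIndependent_iff.mp χ.linearIndependent _ hz s
    refine Prod.ext hy (funext fun j => Subtype.ext ?_)
    simpa [hy] using hj j
  let Φ := E.symm.toLinearMap ∘ₗ J
  -- Modulo `V₀` the cocycle is the homomorphism `∑ s, χ s • y s`, because the action on `C` is
  -- trivial there. It factors through `G`, so relators take values in `V₀`.
  have hΦ : ∀ yz w, (Φ yz).1 w - ∑ s, (χ s).1 (π w) • (yz.1 s : V) ∈ V₀ := by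
    intro yz w
    induction w using FreeGroup.induction_on with
    | C1 =>
      have : ∀ s, (χ s).1 1 = 0 := fun s => crossedHoms_one (χ s).2
      simp [crossedHoms_one (Φ yz).2, this]
    | of i =>
      have : (Φ yz).1 (FreeGroup.of i) = J yz i := hE _ _
      rw [this]
      simp [J]
    | inv_of i ih =>
      have hχ : ∀ s, (χ s).1 (π (FreeGroup.of i))⁻¹ = - (χ s).1 (π (FreeGroup.of i)) :=
        fun s => crossedHoms_inv (χ s).2 _
      rw [crossedHoms_inv (Φ yz).2, map_inv π]
      simp only [hχ, neg_smul, Finset.sum_neg_distrib]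
      have h1 := h₀ (π (FreeGroup.of i)⁻¹) _ ih
      have h2 := hC (π (FreeGroup.of i)⁻¹) _
        (C.sum_mem (t := Finset.univ)
          fun s _ => C.smul_mem ((χ s).1 (π (FreeGroup.of i))) (yz.1 s).2)
      rw [map_sub] at h1
      convert V₀.neg_mem (V₀.add_mem h1 h2) using 1
      simp only [MonoidHom.comp_apply]
      abel
    | mul a b ha hb =>
      have hχ : ∀ s, (χ s).1 (π a * π b) = (χ s).1 (π a) + (χ s).1 (π b) :=
        fun s => (χ s).2 _ _
      rw [(Φ yz).2 a b, map_mul π]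
      simp only [hχ, add_smul, Finset.sum_add_distrib]
      have h1 := h₀ (π a) _ hb
      have h2 := hC (π a) _ (C.sum_mem (t := Finset.univ)
          fun s _ => C.smul_mem ((χ s).1 (π b)) (yz.1 s).2)
      rw [map_sub] at h1
      convert V₀.add_mem ha (V₀.add_mem h1 h2) using 1
      simp only [MonoidHom.comp_apply]
      abel
  have hR : ∀ i, π (R i) = 1 := fun i =>
    MonoidHom.mem_ker.mp (hker ▸ Subgroup.subset_normalClosure ⟨i, rfl⟩)
  have hmem : ∀ yz i, (Φ yz).1 (R i) ∈ V₀ := by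
    intro yz i
    have h1 : ∀ s, (χ s).1 1 = 0 := fun s => crossedHoms_one (χ s).2
    simpa [hR, h1] using hΦ yz (R i)
  let L : ((Fin b → C) × (Fin n → V₀)) →ₗ[K] (Fin n → V₀) :=
    { toFun := fun yz i => ⟨(Φ yz).1 (R i), hmem yz i⟩
      map_add' := fun a b => funext fun i => Subtype.ext (by simp)
      map_smul' := fun c a => funext fun i => Subtype.ext (by simp) }
  -- Rank-nullity: as many relators as generators, so the two terms `n * dim V₀` cancel.
  have hL : b * Module.finrank K C ≤ Module.finrank K (LinearMap.ker L) := by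
    have h1 := L.finrank_range_add_finrank_ker
    have h2 := (LinearMap.range L).finrank_le
    simp only [Module.finrank_prod, Module.finrank_pi_fintype, Finset.sum_const,
      Finset.card_univ, Fintype.card_fin, smul_eq_mul] at h1 h2
    omega
  let P : crossedHoms ρ →ₗ[K] (FreeGroup (Fin n) → V) :=
    { toFun := fun f => f.1 ∘ π
      map_add' := fun _ _ => rfl
      map_smul' := fun _ _ => rfl }
  let Ψ : LinearMap.ker L →ₗ[K] (FreeGroup (Fin n) → V) :=
    (crossedHoms (ρ.comp π)).subtype ∘ₗ Φ ∘ₗ (LinearMap.ker L).subtype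
  have hΨ : Function.Injective Ψ :=
    Subtype.val_injective.comp ((E.symm.injective.comp hJ).comp Subtype.val_injective)
  have hrange : LinearMap.range Ψ ≤ LinearMap.range P := by
    rintro _ ⟨x, rfl⟩
    obtain ⟨f, hf, hfx⟩ := exists_crossedHoms_comp hπ hker (Φ x).2 (by
      rintro _ ⟨i, rfl⟩
      exact congrArg Subtype.val (congrFun x.2 i))
    exact ⟨⟨f, hf⟩, hfx⟩
  calc b * Module.finrank K C ≤ Module.finrank K (LinearMap.ker L) := hL
    _ = Module.finrank K (LinearMap.range Ψ) := (LinearMap.finrank_range_of_inj hΨ).symm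
    _ ≤ Module.finrank K (LinearMap.range P) := Submodule.finrank_mono hrange
    _ ≤ Module.finrank K (crossedHoms ρ) := P.finrank_range_le

end DeficiencyZero

/-! ### Shapiro-type upper bound -/

section TranslationRepresentation

variable (K : Type*) {G σ : Type*} [Field K] [Group G]

/-- Functions on `σ → K`, with `G` acting by translations through a homomorphism to `σ → K`. -/
def translationRep (θ : G →* Multiplicative (σ → K)) : Representation K G ((σ → K) → K) where
  toFun g :=
    { toFun := fun u x => u (x + (θ g).toAdd)
      map_add' := fun _ _ => rfl
      map_smul' := fun _ _ => rfl }
  map_one' := by ext; simp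
  map_mul' g h := by
    refine LinearMap.ext fun u => funext fun x => ?_
    simp [add_assoc]

variable {K}

@[simp]
theorem translationRep_apply (θ : G →* Multiplicative (σ → K)) (g : G) (u : (σ → K) → K)
    (x : σ → K) : translationRep K θ g u x = u (x + (θ g).toAdd) := rfl

/-- A form of Shapiro's lemma: the kernel of the restriction of crossed homomorphisms to the
kernel of `θ` consists of coboundaries. -/
theorem finrank_crossedHoms_translationRep_lt [Fintype K] [Fintype σ]
    (θ : G →* Multiplicative (σ → K)) (hθ : Function.Surjective θ)
    [Module.Finite K (additiveCharacters K θ.ker)] :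
    Module.finrank K (crossedHoms (translationRep K θ)) <
      Module.finrank K (additiveCharacters K θ.ker) + Fintype.card K ^ Fintype.card σ := by
  classical
  let s := Function.surjInv hθ
  have hs : ∀ x, θ (s x) = x := Function.surjInv_eq hθ
  -- The coset `x = 0` is omitted since its representative lies in the kernel; this saves the 1
  -- behind the strict inequality.
  let T : crossedHoms (translationRep K θ) →ₗ[K]
      additiveCharacters K θ.ker × ({x : σ → K // x ≠ 0} → K) :=
    { toFun := fun f => (⟨fun n => f.1 n 0, fun a b => by
          have ha : θ a = 1 := a.2
          simp [f.2 a b, ha]⟩, fun x => f.1 (s (Multiplicative.ofAdd x.1)) 0)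
      map_add' := fun _ _ => rfl
      map_smul' := fun _ _ => rfl }
  have hT : Function.Injective T := by
    refine (injective_iff_map_eq_zero T).mpr fun f hf => ?_
    have h1 : ∀ n : G, θ n = 1 → f.1 n 0 = 0 := fun n hn =>
      congrFun (congrArg Subtype.val (congrArg Prod.fst hf)) ⟨n, hn⟩
    have h2 : ∀ x, f.1 (s x) 0 = 0 := by
      intro x
      by_cases hx : x.toAdd = 0
      · exact h1 _ (by rw [hs]; exact hx)
      · exact congrFun (congrArg Prod.snd hf) ⟨x.toAdd, hx⟩
    have h3 : ∀ g, f.1 g 0 = 0 := by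
      intro g
      have hk : θ (g * (s (θ g))⁻¹) = 1 := by simp [hs]
      have := f.2 (g * (s (θ g))⁻¹) (s (θ g))
      rw [inv_mul_cancel_right] at this
      rw [this, Pi.add_apply, translationRep_apply, hk, h1 _ hk]
      simp [h2]
    refine Subtype.ext (funext fun h => funext fun x => ?_)
    -- If `θ g = x`, then `f h x = f (g * h) 0 - f g 0`.
    obtain ⟨g, hg⟩ := hθ (Multiplicative.ofAdd x)
    have := congrFun (f.2 g h) 0
    simpa [h3, hg] using this.symm
  have hle := LinearMap.finrank_le_finrank_of_injective hT
  rw [Module.finrank_prod, Module.finrank_fintype_fun_eq_card,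
    Fintype.card_subtype_compl, Fintype.card_subtype_eq, Fintype.card_fun] at hle
  have : 0 < Fintype.card K ^ Fintype.card σ := pow_pos Fintype.card_pos _
  omega

end TranslationRepresentation

/-! ### Polynomial functions over a finite field, filtered by degree -/

section MonomialFunctions

theorem exists_eq_add_single {σ : Type*} [DecidableEq σ] {j : σ → ℕ} {i : σ} (hi : j i ≠ 0) :
    ∃ j' : σ → ℕ, j = j' + Pi.single i 1 := by
  refine ⟨j - Pi.single i 1, (tsub_add_cancel_of_le ?_).symm⟩
  intro t
  by_cases h : t = i
  · subst h; simp; omega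
  · simp [h]

variable (K : Type*) {σ : Type*} [Field K] [Fintype σ]

/-- The function `x ↦ ∏ i, x i ^ j i` on `σ → K`. -/
def monomialFunction (j : σ → ℕ) : (σ → K) → K := fun x => ∏ i, x i ^ j i

variable (σ) in
/-- The functions given by polynomials of degree less than `m`. -/
def polynomialFunctionsLT (m : ℕ) : Submodule K ((σ → K) → K) :=
  Submodule.span K (monomialFunction K '' {j | ∑ i, j i < m})

variable {K}

theorem monomialFunction_mem {j : σ → ℕ} {m : ℕ} (h : ∑ i, j i < m) :
    monomialFunction K j ∈ polynomialFunctionsLT K σ m :=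
  Submodule.subset_span ⟨j, h, rfl⟩

theorem polynomialFunctionsLT_mono {m n : ℕ} (h : m ≤ n) :
    polynomialFunctionsLT K σ m ≤ polynomialFunctionsLT K σ n :=
  Submodule.span_mono (Set.image_mono fun _ hj => lt_of_lt_of_le hj h)

theorem monomialFunction_add_single [DecidableEq σ] (j : σ → ℕ) (i : σ) (x : σ → K) :
    monomialFunction K (j + Pi.single i 1) x = x i * monomialFunction K j x := by
  simp only [monomialFunction, Pi.add_apply, pow_add, Finset.prod_mul_distrib]
  rw [mul_comm, Finset.prod_eq_single i (by intro b _ hb; simp [hb]) (by simp)]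
  simp

theorem coordinate_mul_mem_polynomialFunctionsLT (i : σ) {m : ℕ} {u : (σ → K) → K}
    (hu : u ∈ polynomialFunctionsLT K σ m) :
    (fun x => x i * u x) ∈ polynomialFunctionsLT K σ (m + 1) := by
  classical
  induction hu using Submodule.span_induction with
  | mem u hu =>
    obtain ⟨j, hj, rfl⟩ := hu
    simp only [← monomialFunction_add_single]
    refine monomialFunction_mem ?_
    have : ∑ i, j i < m := hj
    simpa [Finset.sum_add_distrib] using this
  | zero => simp only [Pi.zero_apply, mul_zero]; exact Submodule.zero_mem _
  | add u v _ _ hu hv =>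
    simp only [Pi.add_apply, mul_add]
    exact Submodule.add_mem _ hu hv
  | smul c u _ hu =>
    simp only [Pi.smul_apply, smul_eq_mul, mul_left_comm _ c]
    exact Submodule.smul_mem _ c hu

/-- Induction by the product rule: with Δ the difference under translation by `a`, Δ(x_i M) = x_i ΔM
+ a_i (ΔM + M). -/
theorem monomialFunction_translate_sub_mem (a : σ → K) (m : ℕ) :
    ∀ j : σ → ℕ, ∑ i, j i = m →
      (fun x => monomialFunction K j (x + a) - monomialFunction K j x) ∈
        polynomialFunctionsLT K σ m := by
  classical
  induction m with
  | zero =>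
    intro j hj
    have : ∀ i, j i = 0 := by simpa using hj
    simp only [monomialFunction, this, pow_zero, sub_self]
    exact Submodule.zero_mem _
  | succ m ih =>
    intro j hj
    obtain ⟨i, -, hi⟩ := Finset.exists_ne_zero_of_sum_ne_zero (by omega : ∑ i, j i ≠ 0)
    obtain ⟨j, rfl⟩ := exists_eq_add_single hi
    have hj' : ∑ i, j i = m := by simpa [Finset.sum_add_distrib] using hj
    have h1 := ih j hj'
    have h2 := monomialFunction_mem (K := K) (by omega : ∑ i, j i < m + 1)
    convert Submodule.add_mem _ (coordinate_mul_mem_polynomialFunctionsLT i h1)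
      (Submodule.smul_mem _ (a i) (Submodule.add_mem _
        (polynomialFunctionsLT_mono (Nat.le_succ m) h1) h2)) using 1
    funext x
    simp only [monomialFunction_add_single, Pi.add_apply, Pi.smul_apply, smul_eq_mul]
    ring

theorem translate_sub_mem_polynomialFunctionsLT (a : σ → K) {m : ℕ} {u : (σ → K) → K}
    (hu : u ∈ polynomialFunctionsLT K σ (m + 1)) :
    (fun x => u (x + a) - u x) ∈ polynomialFunctionsLT K σ m := by
  induction hu using Submodule.span_induction with
  | mem u hu =>
    obtain ⟨j, hj, rfl⟩ := hu
    exact polynomialFunctionsLT_mono (Nat.lt_succ_iff.mp hj)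
      (monomialFunction_translate_sub_mem a _ j rfl)
  | zero => simp only [Pi.zero_apply, sub_zero]; exact Submodule.zero_mem _
  | add u v _ _ hu hv =>
    convert Submodule.add_mem _ hu hv using 1
    funext x
    simp only [Pi.add_apply]
    ring
  | smul c u _ hu =>
    convert Submodule.smul_mem _ c hu using 1
    funext x
    simp only [Pi.smul_apply, smul_eq_mul]
    ring

variable [Fintype K]

/-- Exponents can be reduced below the cardinality of the field without raising the degree. -/
theorem exists_reduced_monomialFunction (j : σ → ℕ) :
    ∃ j' : σ → ℕ, (∀ i, j' i < Fintype.card K) ∧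
      ∑ i, j' i ≤ ∑ i, j i ∧ monomialFunction K j' = monomialFunction K j := by
  have hq := Fintype.one_lt_card (α := K)
  -- From `x ^ q = x`; the new exponent stays positive, so `x = 0` causes no trouble.
  have hpow : ∀ x : K, ∀ n, Fintype.card K ≤ n → x ^ (n - (Fintype.card K - 1)) = x ^ n := by
    intro x n hn
    obtain ⟨c, rfl⟩ := Nat.exists_eq_add_of_le hn
    rw [pow_add, FiniteField.pow_card, ← pow_succ']
    congr 1
    omega
  have key : ∀ n : ℕ, ∃ n' < Fintype.card K, n' ≤ n ∧ ∀ x : K, x ^ n' = x ^ n := by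
    intro n
    induction n using Nat.strong_induction_on with
    | _ n ih =>
      by_cases hn : n < Fintype.card K
      · exact ⟨n, hn, le_rfl, fun _ => rfl⟩
      · obtain ⟨n', h1, h2, h3⟩ := ih (n - (Fintype.card K - 1)) (by omega)
        exact ⟨n', h1, by omega, fun x => (h3 x).trans (hpow x n (by omega))⟩
  choose r h1 h2 h3 using key
  exact ⟨fun i => r (j i), fun i => h1 _, Finset.sum_le_sum fun i _ => h2 _,
    funext fun x => Finset.prod_congr rfl fun i _ => h3 _ _⟩

/-- A polynomial of degree less than `|K|` in each variable that vanishes at every point is zero. -/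
theorem linearIndependent_monomialFunction :
    LinearIndependent K fun j : {j : σ → ℕ // ∀ i, j i < Fintype.card K} =>
      monomialFunction K j.1 := by
  let e : {j : σ → ℕ // ∀ i, j i < Fintype.card K} → (σ →₀ ℕ) :=
    fun j => Finsupp.equivFunOnFinite.symm j.1
  have he : Function.Injective e :=
    Finsupp.equivFunOnFinite.symm.injective.comp Subtype.val_injective
  have hli : LinearIndependent K fun j => MvPolynomial.basisMonomials σ K (e j) :=
    (MvPolynomial.basisMonomials σ K).linearIndependent.comp e he
  have heq : (fun j : {j : σ → ℕ // ∀ i, j i < Fintype.card K} => monomialFunction K j.1) =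
      MvPolynomial.evalₗ K σ ∘ fun j => MvPolynomial.basisMonomials σ K (e j) := by
    funext j x
    simp [monomialFunction, MvPolynomial.evalₗ_apply, MvPolynomial.eval_monomial, e,
      Finsupp.prod_fintype]
  rw [heq]
  refine hli.map ?_
  refine Submodule.disjoint_def.mpr fun P hP hker => ?_
  suffices h : P ∈ MvPolynomial.restrictDegree σ K (Fintype.card K - 1) by
    refine MvPolynomial.eq_zero_of_eval_zero_at_prod_finset P (fun _ => Finset.univ) (fun i => ?_)
      fun v _ => congrFun hker v
    have hq : 0 < (Finset.univ : Finset K).card := Fintype.card_pos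
    rw [MvPolynomial.degreeOf_lt_iff hq]
    intro s hs
    have := (MvPolynomial.mem_restrictDegree _ _ _).mp h s hs i
    rw [Finset.card_univ] at hq ⊢
    omega
  refine Submodule.span_le.mpr ?_ hP
  rintro _ ⟨j, rfl⟩
  simp only [MvPolynomial.coe_basisMonomials, SetLike.mem_coe, MvPolynomial.mem_restrictDegree]
  intro s hs i
  have : s = e j := by
    simpa using MvPolynomial.support_monomial_subset hs
  subst this
  have := j.2 i
  simp only [e, Finsupp.equivFunOnFinite_symm_apply_apply]
  omega

/-- The span of the reduced monomials of degree `m`. -/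
def homogeneousFunctions (K σ : Type*) [Field K] [Fintype σ] [Fintype K] (m : ℕ) :
    Submodule K ((σ → K) → K) :=
  Submodule.span K ((fun j : {j : σ → ℕ // ∀ i, j i < Fintype.card K} =>
    monomialFunction K j.1) '' {j | ∑ i, j.1 i = m})

theorem homogeneousFunctions_le (m : ℕ) :
    homogeneousFunctions K σ m ≤ polynomialFunctionsLT K σ (m + 1) := by
  refine Submodule.span_le.mpr ?_
  rintro _ ⟨j, hj, rfl⟩
  exact monomialFunction_mem (Nat.lt_succ_iff.mpr (le_of_eq hj))

/-- Reducing exponents never raises the degree, so both sides are spanned by disjoint sets of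
independent reduced monomials. -/
theorem disjoint_homogeneousFunctions (m : ℕ) :
    Disjoint (homogeneousFunctions K σ m) (polynomialFunctionsLT K σ m) := by
  have h := (linearIndependent_monomialFunction (K := K) (σ := σ)).disjoint_span_image
    (s := {j | ∑ i, j.1 i = m}) (t := {j | ∑ i, j.1 i < m})
    (Set.disjoint_left.mpr fun _ h1 h2 => (ne_of_lt h2) h1)
  refine h.mono_right (Submodule.span_le.mpr ?_)
  rintro _ ⟨j, hj, rfl⟩
  obtain ⟨j', h1, h2, h3⟩ := exists_reduced_monomialFunction (K := K) j
  rw [← h3]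
  exact Submodule.subset_span ⟨⟨j', h1⟩, lt_of_le_of_lt h2 hj, rfl⟩

end MonomialFunctions

theorem finrank_homogeneousFunctions (K : Type*) [Field K] [Fintype K] (r m : ℕ) :
    Module.finrank K (homogeneousFunctions K (Fin r) m) = (Omega (Fintype.card K) r m).card := by
  have hli := (linearIndependent_monomialFunction (K := K) (σ := Fin r)).comp
    (fun j : {j : {j : Fin r → ℕ // ∀ i, j i < Fintype.card K} // ∑ i, j.1 i = m} => j.1)
    Subtype.val_injective
  let e : {j : {j : Fin r → ℕ // ∀ i, j i < Fintype.card K} // ∑ i, j.1 i = m} ≃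
      Omega (Fintype.card K) r m :=
    { toFun := fun j => ⟨j.1.1, by simpa [Omega] using ⟨j.1.2, j.2⟩⟩
      invFun := fun j => ⟨⟨j.1, by have := j.2; simp [Omega] at this; exact this.1⟩,
        by have := j.2; simp [Omega] at this; exact this.2⟩
      left_inv := fun _ => rfl
      right_inv := fun _ => rfl }
  have := Fintype.ofEquiv _ e.symm
  have h := finrank_span_eq_card hli
  rw [Fintype.card_congr e, Fintype.card_coe] at h
  have himage := Set.range_comp (fun j : {j : Fin r → ℕ // ∀ i, j i < Fintype.card K} =>
    monomialFunction K j.1) (Subtype.val (p := fun j => ∑ i, j.1 i = m))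
  rw [Subtype.range_coe_subtype] at himage
  rw [← h, homogeneousFunctions, ← himage]

/-- Needed only in the equality case, to cancel the factor `|Ω|`. -/
theorem Omega_nonempty {p : ℕ} (hp : 0 < p) (r k : ℕ) (hk : k ≤ r * (p - 1)) :
    (Omega p r k).Nonempty := by
  induction k with
  | zero => exact ⟨0, by simp [Omega, hp]⟩
  | succ k ih =>
    obtain ⟨j, hj⟩ := ih (by omega)
    simp only [Omega, Finset.mem_filter, Fintype.mem_piFinset, Finset.mem_range] at hj
    obtain ⟨i, hi⟩ : ∃ i, j i < p - 1 := by
      by_contra! h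
      have := Finset.card_nsmul_le_sum Finset.univ j (p - 1) fun i _ => h i
      rw [Finset.card_univ, Fintype.card_fin, smul_eq_mul, hj.2] at this
      omega
    refine ⟨j + Pi.single i 1, ?_⟩
    simp only [Omega, Finset.mem_filter, Fintype.mem_piFinset, Finset.mem_range, Pi.add_apply,
      Finset.sum_add_distrib, hj.2, Finset.sum_pi_single', Finset.mem_univ, if_true, and_true]
    intro t
    by_cases ht : t = i
    · subst ht; simp; omega
    · simpa [ht] using hj.1 t

/-! ### First homology and additive characters -/

section FirstHomology

universe v

variable (K : Type v) (Γ : Type v) [Field K] [Group Γ]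

/-- The class of a group element in the first homology with trivial coefficients. -/
noncomputable def homologyClass : Γ →
    groupHomology.H1 (Rep.trivial K Γ K) :=
  fun g => groupHomology.H1π _ ((groupHomology.cycles₁IsoOfIsTrivial _).inv (Finsupp.single g 1))

variable {K Γ}

theorem homologyClass_smul (c : K) (g : Γ) :
    c • homologyClass K Γ g = groupHomology.H1π (Rep.trivial K Γ K)
      ((groupHomology.cycles₁IsoOfIsTrivial _).inv (Finsupp.single g c)) := by
  rw [homologyClass, ← map_smul, ← map_smul, Finsupp.smul_single, smul_eq_mul, mul_one]

theorem homologyClass_smul_eq_symm_tmul (c : K) (g : Γ) :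
    c • homologyClass K Γ g = (groupHomology.H1AddEquivOfIsTrivial (Rep.trivial K Γ K)).symm
      (TensorProduct.tmul ℤ (Additive.ofMul (Abelianization.of g)) c) := by
  rw [homologyClass_smul]
  exact (groupHomology.H1AddEquivOfIsTrivial_symm_tmul (Rep.trivial K Γ K) g c).symm

theorem span_homologyClass : Submodule.span K (Set.range (homologyClass K Γ)) = ⊤ := by
  refine top_unique fun x _ => ?_
  obtain ⟨t, rfl⟩ := (groupHomology.H1AddEquivOfIsTrivial (Rep.trivial K Γ K)).symm.surjective x
  induction t using TensorProduct.induction_on with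
  | zero => rw [map_zero]; exact Submodule.zero_mem _
  | tmul a c =>
    obtain ⟨g, hg⟩ := QuotientGroup.mk_surjective a.toMul
    have : a = Additive.ofMul (Abelianization.of g) := hg.symm
    rw [this, ← homologyClass_smul_eq_symm_tmul]
    exact Submodule.smul_mem _ _ (Submodule.subset_span ⟨g, rfl⟩)
  | add s t hs ht => rw [map_add]; exact Submodule.add_mem _ (hs trivial) (ht trivial)

theorem homologyClass_mul (g h : Γ) :
    homologyClass K Γ (g * h) = homologyClass K Γ g + homologyClass K Γ h := by
  have := homologyClass_smul_eq_symm_tmul (1 : K) (g * h)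
  rw [map_mul, ofMul_mul, TensorProduct.add_tmul, map_add, ← homologyClass_smul_eq_symm_tmul,
    ← homologyClass_smul_eq_symm_tmul] at this
  simpa using this

/-- Universal coefficients in degree one. -/
theorem finrank_H1_eq_finrank_additiveCharacters :
    Module.finrank K (groupHomology.H1 (Rep.trivial K Γ K)) =
      Module.finrank K (additiveCharacters K Γ) := by
  rw [← Subspace.dual_finrank_eq]
  let T : Module.Dual K (groupHomology.H1 (Rep.trivial K Γ K)) →ₗ[K] additiveCharacters K Γ :=
    { toFun := fun φ => ⟨fun g => φ (homologyClass K Γ g),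
        fun g h => (congrArg φ (homologyClass_mul g h)).trans (map_add φ _ _)⟩
      map_add' := fun _ _ => rfl
      map_smul' := fun _ _ => rfl }
  refine (LinearEquiv.ofBijective T ⟨?_, ?_⟩).finrank_eq
  · refine (injective_iff_map_eq_zero T).mpr fun φ hφ => ?_
    refine LinearMap.ext_on span_homologyClass ?_
    rintro _ ⟨g, rfl⟩
    exact congrFun (congrArg Subtype.val hφ) g
  · intro f
    let f₁ : Γ →* Multiplicative K :=
      { toFun := fun g => Multiplicative.ofAdd (f.1 g)
        map_one' := by rw [crossedHoms_one f.2]; rfl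
        map_mul' := fun g h => congrArg Multiplicative.ofAdd (f.2 g h) }
    let f₂ : Additive (Abelianization Γ) →+ K :=
      MonoidHom.toAdditiveLeft (Abelianization.lift f₁)
    let B : Additive (Abelianization Γ) →ₗ[ℤ] K →ₗ[ℤ] K :=
      (LinearMap.mul ℤ K).comp f₂.toIntLinearMap
    let Ψ : groupHomology.H1 (Rep.trivial K Γ K) →+ K :=
      (TensorProduct.lift B).toAddMonoidHom.comp
        (groupHomology.H1AddEquivOfIsTrivial (Rep.trivial K Γ K)).toAddMonoidHom
    have hΨ : ∀ c g, Ψ (c • homologyClass K Γ g) = f.1 g * c := by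
      intro c g
      rw [homologyClass_smul_eq_symm_tmul]
      change TensorProduct.lift B ((groupHomology.H1AddEquivOfIsTrivial (Rep.trivial K Γ K))
        ((groupHomology.H1AddEquivOfIsTrivial (Rep.trivial K Γ K)).symm _)) = _
      rw [AddEquiv.apply_symm_apply]
      rfl
    -- The isomorphism with Γ^ab ⊗ K is only additive, so `K`-linearity is checked on the spanning
    -- classes.
    have hsmul : ∀ (c : K) x, Ψ (c • x) = c • Ψ x := by
      intro c x
      have hx : x ∈ Submodule.span K (Set.range (homologyClass K Γ)) :=
        (span_homologyClass (K := K) (Γ := Γ)).symm ▸ Submodule.mem_top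
      induction hx using Submodule.span_induction generalizing c with
      | mem x hx =>
        obtain ⟨g, rfl⟩ := hx
        have := hΨ 1 g
        rw [one_smul, mul_one] at this
        rw [hΨ, this, smul_eq_mul, mul_comm]
      | zero => simp
      | add x y _ _ hx hy => rw [smul_add, map_add, map_add, hx, hy, smul_add]
      | smul d x _ hx => rw [smul_smul, hx, hx, smul_smul]
    refine ⟨{ toFun := Ψ, map_add' := map_add Ψ, map_smul' := hsmul }, ?_⟩
    refine Subtype.ext (funext fun g => ?_)
    have := hΨ 1 g
    rwa [one_smul, mul_one] at this

end FirstHomology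

/-! ### Assembling the bound -/

/-- The Betti number is the dimension of the space of homomorphisms to the coefficient field. -/
theorem b1_eq_finrank_additiveCharacters (p : ℕ) [Fact p.Prime] (Γ : Type u) [Group Γ] :
    b1 p Γ = Module.finrank (ULift.{u} (ZMod p)) (additiveCharacters (ULift.{u} (ZMod p)) Γ) :=
  finrank_H1_eq_finrank_additiveCharacters

theorem HasBalancedPresentation.fg {G : Type*} [Group G] (hG : HasBalancedPresentation G) :
    Group.FG G := by
  obtain ⟨n, R, ⟨e⟩⟩ := hG
  exact Group.fg_of_surjective (f := e.toMonoidHom.comp (PresentedGroup.mk (Set.range R)))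
    (e.surjective.comp (PresentedGroup.mk_surjective _))

theorem le_finrank_additiveCharacters {K G σ : Type*} [Field K] [Group G] [Fintype σ]
    [Module.Finite K (additiveCharacters K G)]
    (θ : G →* Multiplicative (σ → K)) (hθ : Function.Surjective θ) :
    Fintype.card σ ≤ Module.finrank K (additiveCharacters K G) := by
  classical
  let T : (σ → K) →ₗ[K] additiveCharacters K G :=
    { toFun := fun c => ⟨fun g => ∑ i, c i * (θ g).toAdd i, fun g h => by
        simp [mul_add, Finset.sum_add_distrib]⟩
      map_add' := fun a b => by
        refine Subtype.ext (funext fun g => ?_)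
        simp [add_mul, Finset.sum_add_distrib]
      map_smul' := fun a b => by
        refine Subtype.ext (funext fun g => ?_)
        simp [mul_assoc, Finset.mul_sum] }
  have hT : Function.Injective T := by
    refine (injective_iff_map_eq_zero T).mpr fun c hc => funext fun i => ?_
    obtain ⟨g, hg⟩ := hθ (Multiplicative.ofAdd (Pi.single i 1))
    have : ∑ t, c t * (θ g).toAdd t = 0 := congrFun (congrArg Subtype.val hc) g
    simpa [hg, Pi.single_apply] using this
  simpa using LinearMap.finrank_le_finrank_of_injective hT

/-- The lower bound in terms of the rank of the space of additive characters of the group. -/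
theorem finrank_mul_card_Omega_lt {K G : Type*} [Field K] [Fintype K] [Group G]
    (hG : HasBalancedPresentation G) {r : ℕ} (θ : G →* Multiplicative (Fin r → K))
    (hθ : Function.Surjective θ) [Module.Finite K (additiveCharacters K θ.ker)] (m : ℕ) :
    Module.finrank K (additiveCharacters K G) * (Omega (Fintype.card K) r m).card <
      Module.finrank K (additiveCharacters K θ.ker) + Fintype.card K ^ r := by
  have h := finrank_mul_le_finrank_crossedHoms hG (translationRep K θ)
    (polynomialFunctionsLT K (Fin r) m) (homogeneousFunctions K (Fin r) m)
    (disjoint_homogeneousFunctions m)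
    (fun g v hv => by
      have := translate_sub_mem_polynomialFunctionsLT (θ g).toAdd
        (polynomialFunctionsLT_mono (Nat.le_succ m) hv)
      convert Submodule.add_mem _ this hv using 1
      exact (sub_add_cancel (translationRep K θ g v) v).symm)
    (fun g v hv => translate_sub_mem_polynomialFunctionsLT (θ g).toAdd
      (homogeneousFunctions_le m hv))
  have h' := finrank_crossedHoms_translationRep_lt θ hθ
  rw [finrank_homogeneousFunctions] at h
  rw [Fintype.card_fin] at h'
  exact lt_of_le_of_lt h h'

theorem theorem6p4 {G : Type u} [Group G] (hG : HasBalancedPresentation G)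
    (p : ℕ) [Fact p.Prime] (r : ℕ) (N : Subgroup G) [N.Normal]
    (hN : Nonempty (G ⧸ N ≃* Multiplicative (Fin r → ZMod p))) :
    (b1 p N : ℤ) ≥ 1 + r * (Omega p r (r * (p - 1) / 2)).card - p ^ r ∧
    ((b1 p N : ℤ) = 1 + r * (Omega p r (r * (p - 1) / 2)).card - p ^ r → b1 p G = r) := by
  obtain ⟨e⟩ := hN
  let K := ULift.{u} (ZMod p)
  have hcard : Fintype.card K = p := by rw [Fintype.card_ulift, ZMod.card]
  let up : (Fin r → ZMod p) ≃+ (Fin r → K) := AddEquiv.piCongrRight fun _ => AddEquiv.ulift.symm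
  let E : G ⧸ N ≃* Multiplicative (Fin r → K) := e.trans up.toMultiplicative
  let θ : G →* Multiplicative (Fin r → K) := E.toMonoidHom.comp (QuotientGroup.mk' N)
  have hθ : Function.Surjective θ := E.surjective.comp (QuotientGroup.mk'_surjective N)
  have hker : θ.ker = N := by
    ext g
    change E _ = 1 ↔ _
    rw [EmbeddingLike.map_eq_one_iff]
    exact QuotientGroup.eq_one_iff g
  clear_value θ
  subst hker
  have := hG.fg
  have : Finite (G ⧸ θ.ker) := Finite.of_equiv _ E.symm.toEquiv
  have : θ.ker.FiniteIndex := Subgroup.finiteIndex_of_finite_quotient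
  have : Group.FG θ.ker := inferInstance
  have := finite_crossedHoms (ρ := Representation.trivial K θ.ker K)
  have := finite_crossedHoms (ρ := Representation.trivial K G K)
  have hlt := finrank_mul_card_Omega_lt hG θ hθ (r * (p - 1) / 2)
  have hr := le_finrank_additiveCharacters θ hθ
  rw [Fintype.card_fin, ← b1_eq_finrank_additiveCharacters] at hr
  rw [hcard, ← b1_eq_finrank_additiveCharacters, ← b1_eq_finrank_additiveCharacters] at hlt
  have hpos := Finset.card_pos.mpr
    (Omega_nonempty (Fact.out : p.Prime).pos r (r * (p - 1) / 2) (Nat.div_le_self _ _))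
  generalize (Omega p r (r * (p - 1) / 2)).card = w at *
  have hmul := Nat.mul_le_mul_right w hr
  zify at hlt hmul
  -- `r * w ≤ b₁(G) * w < b₁(N) + p ^ r`; over the integers, strictness supplies the 1, and equality
  -- for `N` squeezes `b₁(G) * w` down to `r * w`.
  refine ⟨by linarith, fun heq => le_antisymm ?_ hr⟩
  have : (b1 p G : ℤ) * w ≤ r * w := by linarith
  exact Nat.le_of_mul_le_mul_right (by exact_mod_cast this) hpos
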